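/- **Setting.** Let $\Omega$ be a set and $\mathcal H$ a linear space of functions $\Omega\to\mathbb R$ that contains the constants and is such that $|X|\in\mathcal H$ for $X\in\mathcal H$ and $\psi(X_1,\dots,X_n)\in\mathcal H$ for all $X_1,\dots,X_n\in\mathcal H$ and all bounded Lipschitz $\psi:\mathbb R^n\to\mathbb R$. Let $\hat{\mathbb E}:\mathcal H\to\mathbb R$ be a sublinear expectation, i.e. $\hat{\mathbb E}[X]\ge\hat{\mathbb E}[Y]$ if $X\ge Y$, $\hat{\mathbb E}[c]=c$ for constants $c$, $\hat{\mathbb E}[X+Y]\le\hat{\mathbb E}[X]+\hat{\mathbb E}[Y]$, and $\hat{\mathbb E}[\lambda X]=\lambda\hat{\mathbb E}[X]$ for $\lambda\ge0$. Let $\hat{\mathcal H}\supseteq\mathcal H$ be the completion of $\mathcal H$ for $\hat{\mathbb E}[|\cdot|]$, realized by functions: $Z:\Omega\to\mathbb R$ belongs to $\hat{\mathcal H}$ if for each $\varepsilon>0$ there are $Y,W\in\mathcal H$ with $|Z-Y|\le W$ and $\hat{\mathbb E}[W]\le\varepsilon$. The functional $\hat{\mathbb E}$ extends continuously, in a unique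 way, to $\hat{\mathcal H}$; the extension is again denoted $\hat{\mathbb E}$. A sequence $(X_i)_{i\ge1}$ in $\hat{\mathcal H}$ is called independent if for every $n\ge1$ and every bounded Lipschitz $\psi:\mathbb R^{n+1}\to\mathbb R$, $$\hat{\mathbb E}[\psi(X_1,\dots,X_{n+1})]=\hat{\mathbb E}\Big[\hat{\mathbb E}[\psi(x_1,\dots,x_n,X_{n+1})]\big|_{(x_1,\dots,x_n)=(X_1,\dots,X_n)}\Big].$$ **Theorem.** Let $(X_i)_{i\ge1}$ be an independent sequence in $\hat{\mathcal H}$ with $\hat{\mathbb E}[X_i]=\overline\mu$ and $-\hat{\mathbb E}[-X_i]=\underline\mu$ for all $i\ge1$, and let $S_n=X_1+\cdots+X_n$. Suppose that for some $\alpha\in(0,1]$ one has $|X_i|^{1+\alpha}\in\hat{\mathcal H}$ for all $i$ and $$C_\alpha=\sup_{i\ge1}\hat{\mathbb E}\big[|X_i|^{1+\alpha}\big]<\infty .$$ Then, for every $\varphi:\mathbb R\to\mathbb R$ that is Lipschitz with constant $L_\varphi$, the maximum of $\varphi$ over $[\underline\mu,\overline\mu]$ exists, and for every $n\ge1$ one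 has $\varphi(S_n/n)\in\hat{\mathcal H}$ and $$\left|\hat{\mathbb E}\Big[\varphi\Big(\frac{S_n}{n}\Big)\Big]-\max_{r\in[\underline\mu,\overline\mu]}\varphi(r)\right|\le L_\varphi\left(\frac{4C_\alpha}{n^\alpha}\right)^{\frac1{1+\alpha}}.$$ -/

import Mathlib

/-- Bounded Lipschitz functions on `ℝⁿ` (the class does not depend on the chosen norm of `ℝⁿ`). -/
def IsBoundedLipschitz {n : ℕ} (φ : (Fin n → ℝ) → ℝ) : Prop :=
  (∃ K : NNReal, LipschitzWith K φ) ∧ ∃ M : ℝ, ∀ x, |φ x| ≤ M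

/-- A sublinear expectation space `(Ω, H, Ê)`. -/
structure SublinearExpectationSpace (Ω : Type*) where
  /-- the linear space of random variables -/
  H : Submodule ℝ (Ω → ℝ)
  const_mem : ∀ c : ℝ, (fun _ : Ω => c) ∈ H
  abs_mem : ∀ X ∈ H, (fun ω => |X ω|) ∈ H
  comp_mem : ∀ (n : ℕ) (X : Fin n → Ω → ℝ), (∀ i, X i ∈ H) →
    ∀ φ : (Fin n → ℝ) → ℝ, IsBoundedLipschitz φ → (fun ω => φ (fun i => X i ω)) ∈ H
  /-- the sublinear expectation -/
  E : H → ℝ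
  mono : ∀ X Y : H, (∀ ω, Y.1 ω ≤ X.1 ω) → E Y ≤ E X
  const : ∀ c : ℝ, E ⟨fun _ => c, const_mem c⟩ = c
  subadd : ∀ X Y : H, E (X + Y) ≤ E X + E Y
  pos_homog : ∀ (l : ℝ) (X : H), 0 ≤ l → E (l • X) = l * E X

namespace SublinearExpectationSpace

variable {Ω : Type*} (S : SublinearExpectationSpace Ω)

/-- `Z` is at distance at most `ε` from the random variable `Y` for the norm `Ê[|·|]`: the
difference `|Z - Y|` is dominated by some `W ∈ H` with `Ê[W] ≤ ε`.  If `Z - Y ∈ H` this says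
exactly that `Ê[|Z - Y|] ≤ ε`, see `approx_iff`. -/
def Approx (Z : Ω → ℝ) (Y : S.H) (ε : ℝ) : Prop :=
  ∃ W : S.H, (∀ ω, |Z ω - Y.1 ω| ≤ W.1 ω) ∧ S.E W ≤ ε

/-- `Z` belongs to the completion of `H` for the norm `Ê[|·|]` (realized by functions on `Ω`):
it can be approximated arbitrarily well by elements of `H`. -/
def MemCompletion (Z : Ω → ℝ) : Prop :=
  ∀ ε : ℝ, 0 < ε → ∃ Y : S.H, S.Approx Z Y ε

/-- The sublinear expectation `Ê[Z]`.  It coincides with `S.E` on `H` (`expect_coe`), and on the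
completion of `H` it is the continuous extension of `S.E` (`abs_expect_sub_le` and
`tendsto_expect`; uniqueness of the limit gives uniqueness of the extension). -/
noncomputable def expect (Z : Ω → ℝ) : ℝ :=
  sInf {c : ℝ | ∃ Y : S.H, (∀ ω, Z ω ≤ Y.1 ω) ∧ S.E Y = c}

/-- The members `X 0, X 1, …` of a sequence are independent: for every `n`, the variable `X n` is
independent of `(X 0, …, X (n - 1))`. -/
def Independent (X : ℕ → Ω → ℝ) : Prop :=
  ∀ (n : ℕ) (φ : (Fin (n + 1) → ℝ) → ℝ), IsBoundedLipschitz φ →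
    S.expect (fun ω => φ (fun i : Fin (n + 1) => X i ω)) =
      S.expect (fun ω => S.expect (fun ω' =>
        φ (Fin.snoc (α := fun _ => ℝ) (fun i : Fin n => X i ω) (X n ω'))))

theorem expect_coe (Y : S.H) : S.expect Y.1 = S.E Y := by
  have h : IsLeast {c : ℝ | ∃ Y' : S.H, (∀ ω, Y.1 ω ≤ Y'.1 ω) ∧ S.E Y' = c} (S.E Y) := by
    refine ⟨⟨Y, fun _ => le_rfl, rfl⟩, ?_⟩
    rintro c ⟨Y', h, rfl⟩
    exact S.mono _ _ h
  exact h.csInf_eq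

theorem approx_iff (X Y : S.H) (ε : ℝ) :
    S.Approx X.1 Y ε ↔ S.E ⟨fun ω => |(X - Y).1 ω|, S.abs_mem _ (X - Y).2⟩ ≤ ε := by
  constructor
  · rintro ⟨W, hW, h⟩
    exact (S.mono _ _ (fun ω => by simpa using hW ω)).trans h
  · intro h
    exact ⟨_, fun ω => by simp, h⟩

theorem memCompletion_coe (Y : S.H) : S.MemCompletion Y.1 := by
  intro ε hε
  refine ⟨Y, ⟨_, S.const_mem 0⟩, by simp, ?_⟩
  rw [S.const]
  exact hε.le

theorem abs_expect_sub_le {Z : Ω → ℝ} {Y : S.H} {ε : ℝ} (h : S.Approx Z Y ε) :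
    |S.expect Z - S.E Y| ≤ ε := by
  obtain ⟨W, hW, hε⟩ := h
  have hlow : ∀ Y' : S.H, (∀ ω, Z ω ≤ Y'.1 ω) → S.E Y - ε ≤ S.E Y' := by
    intro Y' hY'
    have h1 : S.E Y ≤ S.E (Y' + W) := S.mono _ _ fun ω => by
      have h2 := (abs_le.1 (hW ω)).1
      have h3 := hY' ω
      change Y.1 ω ≤ Y'.1 ω + W.1 ω
      linarith
    have h4 := S.subadd Y' W
    linarith
  have hmem : S.E (Y + W) ∈ {c : ℝ | ∃ Y' : S.H, (∀ ω, Z ω ≤ Y'.1 ω) ∧ S.E Y' = c} := by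
    refine ⟨Y + W, fun ω => ?_, rfl⟩
    have h2 := (abs_le.1 (hW ω)).2
    change Z ω ≤ Y.1 ω + W.1 ω
    linarith
  have h5 : S.E Y - ε ≤ S.expect Z := by
    refine le_csInf ⟨_, hmem⟩ ?_
    rintro c ⟨Y', hY', rfl⟩
    exact hlow Y' hY'
  have h6 : S.expect Z ≤ S.E (Y + W) := by
    refine csInf_le ⟨S.E Y - ε, ?_⟩ hmem
    rintro c ⟨Y', hY', rfl⟩
    exact hlow Y' hY'
  have h7 := S.subadd Y W
  rw [abs_le]
  constructor <;> linarith

theorem tendsto_expect {Z : Ω → ℝ} {Y : ℕ → S.H} {ε : ℕ → ℝ}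
    (hε : Filter.Tendsto ε Filter.atTop (nhds 0)) (h : ∀ k, S.Approx Z (Y k) (ε k)) :
    Filter.Tendsto (fun k => S.E (Y k)) Filter.atTop (nhds (S.expect Z)) := by
  rw [tendsto_iff_dist_tendsto_zero]
  refine squeeze_zero (fun _ => dist_nonneg) (fun k => ?_) hε
  rw [dist_comm, Real.dist_eq]
  exact S.abs_expect_sub_le (h k)

end SublinearExpectationSpace

/-! Since `φ` is Lipschitz, both halves of the estimate reduce to first absolute moments of `S_n`.
For the upper half, `φ (S_n / n)` exceeds the maximum by at most `L / n` times the distance `D` of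
`S_n` from `[n μl, n μu]`. For the lower half, fix a maximizer `r`; then `φ (S_n / n)` falls below
`φ r` by at most `L / n * |S_n - n r|`, and it suffices to bound the lower expectation of `|S_n - n
r|`.

Both bounds come from moments of order `1 + α`, which grow by at most `4 C` per summand. The tool is
`|a + b|^(1+α) ≤ |a|^(1+α) + (1+α) sgn(a) |a|^α b + 2^(1-α) |b|^(1+α)` with `b = X_n - m`. For the
upper half, `m` is the upper mean if the current deviation is nonnegative and the lower mean
otherwise, so the linear term has nonpositive expectation. For the lower half `m = r`, and both `X_n
- r` and `r - X_n` have nonnegative upper expectation. The remainder costs `2^(1-α) * 2^α * 2 C = 4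
C`. Jensen's inequality turns `n * 4 C` into a first moment bound `(n * 4 C)^(1/(1+α))`.

Independence is given only for bounded Lipschitz functions. Clipping and the moment bound extend it
to Lipschitz functions of partial sums; the power itself is replaced by `truncPow`, which is
Lipschitz and satisfies the same Taylor bound. Jensen needs only one tangent line, at `t`, and this
line stays below the power truncated at `N = t`, so no limit in `N` is taken there. -/

/-! ### Elementary inequalities for real powers -/

theorem Real.add_rpow_one_add_le {α : ℝ} (hα : 0 ≤ α) {a b : ℝ} (ha : 0 ≤ a) (hb : 0 ≤ b) :
    (a + b) ^ (1 + α) ≤ 2 ^ α * (a ^ (1 + α) + b ^ (1 + α)) := by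
  have h := NNReal.rpow_add_le_mul_rpow_add_rpow ⟨a, ha⟩ ⟨b, hb⟩ (p := 1 + α) (by linarith)
  rw [add_sub_cancel_left] at h
  exact_mod_cast h

theorem Real.abs_add_rpow_one_add_le {α : ℝ} (hα : 0 ≤ α) (a b : ℝ) :
    |a + b| ^ (1 + α) ≤ 2 ^ α * (|a| ^ (1 + α) + |b| ^ (1 + α)) :=
  (Real.rpow_le_rpow (abs_nonneg _) (abs_add_le a b) (by linarith)).trans
    (Real.add_rpow_one_add_le hα (abs_nonneg a) (abs_nonneg b))

/-- Concavity of `x ↦ x ^ α` at the midpoint of `a` and `b`. -/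
theorem Real.rpow_add_rpow_le_two_rpow_mul {α : ℝ} (hα : 0 ≤ α) (hα' : α ≤ 1) {a b : ℝ}
    (ha : 0 ≤ a) (hb : 0 ≤ b) : a ^ α + b ^ α ≤ 2 ^ (1 - α) * (a + b) ^ α := by
  have h := (Real.concaveOn_rpow hα hα').2 (Set.mem_Ici.2 ha) (Set.mem_Ici.2 hb)
    (by norm_num : (0 : ℝ) ≤ 1 / 2) (by norm_num : (0 : ℝ) ≤ 1 / 2) (by norm_num)
  simp only [smul_eq_mul] at h
  rw [← mul_add, ← mul_add, Real.mul_rpow (by norm_num) (by positivity),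
    Real.div_rpow (by norm_num) (by norm_num), Real.one_rpow] at h
  rw [Real.rpow_sub two_pos, Real.rpow_one]
  have h2 : (0 : ℝ) < 2 ^ α := by positivity
  field_simp at h ⊢
  linarith

theorem Real.abs_rpow_sub_rpow_le {α : ℝ} (hα : 0 ≤ α) (hα' : α ≤ 1) {a b : ℝ}
    (ha : 0 ≤ a) (hb : 0 ≤ b) : |a ^ α - b ^ α| ≤ |a - b| ^ α := by
  wlog hab : b ≤ a generalizing a b
  · rw [abs_sub_comm, abs_sub_comm a]
    exact this hb ha (le_of_not_ge hab)
  rw [abs_of_nonneg (sub_nonneg.2 (Real.rpow_le_rpow hb hab hα)), abs_of_nonneg (sub_nonneg.2 hab)]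
  have := Real.rpow_add_le_add_rpow (sub_nonneg.2 hab) hb hα hα'
  rw [sub_add_cancel] at this
  linarith

/-- The tangent line of `x ↦ x ^ (1 + α)` at `t` lies below the graph. -/
theorem Real.tangent_le_rpow_one_add {α : ℝ} (hα : 0 ≤ α) {x t : ℝ} (hx : 0 ≤ x) (ht : 0 < t) :
    t ^ (1 + α) + (1 + α) * t ^ α * (x - t) ≤ x ^ (1 + α) := by
  -- Bernoulli's inequality at `x / t`, to be rescaled by `t ^ (1 + α)`.
  have h := one_add_mul_self_le_rpow_one_add (s := x / t - 1) (p := 1 + α)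
    (by have : 0 ≤ x / t := by positivity
        linarith) (by linarith)
  rw [add_sub_cancel, Real.div_rpow hx ht.le, le_div_iff₀ (by positivity)] at h
  refine le_trans (le_of_eq ?_) h
  rw [Real.rpow_add ht, Real.rpow_one]
  field_simp

/-! ### The power `|s| ^ (1 + α)` with truncated slope -/

/-- The odd extension of `u ↦ u ^ α` from the nonnegative reals. -/
noncomputable def signedPow (α u : ℝ) : ℝ := max u 0 ^ α - max (-u) 0 ^ α

theorem signedPow_neg (α u : ℝ) : signedPow α (-u) = -signedPow α u := by
  simp [signedPow]

theorem signedPow_of_nonneg {α u : ℝ} (hα : 0 < α) (hu : 0 ≤ u) : signedPow α u = u ^ α := by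
  simp [signedPow, hu, Real.zero_rpow hα.ne']

theorem continuous_signedPow {α : ℝ} (hα : 0 < α) : Continuous (signedPow α) := by
  unfold signedPow
  exact ((continuous_id.max continuous_const).rpow_const fun _ => Or.inr hα.le).sub
    ((continuous_neg.max continuous_const).rpow_const fun _ => Or.inr hα.le)

/-- For equal signs the Hölder constant `1` suffices; opposite signs force `2 ^ (1 - α)`, by
concavity. -/
theorem abs_signedPow_sub_le {α : ℝ} (hα : 0 < α) (hα' : α ≤ 1) (u v : ℝ) :
    |signedPow α u - signedPow α v| ≤ 2 ^ (1 - α) * |u - v| ^ α := by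
  have same : ∀ u v : ℝ, 0 ≤ u → 0 ≤ v →
      |signedPow α u - signedPow α v| ≤ 2 ^ (1 - α) * |u - v| ^ α := by
    intro u v hu hv
    rw [signedPow_of_nonneg hα hu, signedPow_of_nonneg hα hv]
    refine (Real.abs_rpow_sub_rpow_le hα.le hα' hu hv).trans ?_
    exact le_mul_of_one_le_left (by positivity)
      (Real.one_le_rpow one_le_two (sub_nonneg.2 hα'))
  have opp : ∀ u v : ℝ, 0 ≤ u → v ≤ 0 →
      |signedPow α u - signedPow α v| ≤ 2 ^ (1 - α) * |u - v| ^ α := by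
    intro u v hu hv
    obtain ⟨w, rfl⟩ : ∃ w, v = -w := ⟨-v, (neg_neg v).symm⟩
    have hw : 0 ≤ w := by linarith
    rw [signedPow_neg, signedPow_of_nonneg hα hu, signedPow_of_nonneg hα hw, sub_neg_eq_add,
      sub_neg_eq_add, abs_of_nonneg (by positivity), abs_of_nonneg (by positivity)]
    exact Real.rpow_add_rpow_le_two_rpow_mul hα.le hα' hu hw
  rcases le_total 0 u with hu | hu <;> rcases le_total 0 v with hv | hv
  · exact same u v hu hv
  · exact opp u v hu hv
  · rw [abs_sub_comm, abs_sub_comm u]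
    exact opp v u hv hu
  · have := same (-u) (-v) (by linarith) (by linarith)
    rw [signedPow_neg, signedPow_neg] at this
    rw [abs_sub_comm, abs_sub_comm u]
    convert this using 2 <;> ring_nf

/-- The derivative of `truncPow`. -/
noncomputable def truncPowDeriv (α N u : ℝ) : ℝ := (1 + α) * signedPow α (max (-N) (min u N))

/-- The even convex function that agrees with `|s| ^ (1 + α)` for `|s| ≤ N` and is affine on each
of the two remaining half-lines. -/
noncomputable def truncPow (α N s : ℝ) : ℝ := ∫ u in (0 : ℝ)..s, truncPowDeriv α N u

section TruncPow

variable {α N : ℝ}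

theorem truncPow_zero : truncPow α N 0 = 0 := by simp [truncPow]

theorem truncPowDeriv_neg (hN : 0 ≤ N) (u : ℝ) :
    truncPowDeriv α N (-u) = -truncPowDeriv α N u := by
  have : max (-N) (min (-u) N) = -max (-N) (min u N) := by
    grind
  rw [truncPowDeriv, this, signedPow_neg, truncPowDeriv, mul_neg]

theorem truncPowDeriv_nonneg (hα : 0 < α) (hN : 0 ≤ N) {u : ℝ} (hu : 0 ≤ u) :
    0 ≤ truncPowDeriv α N u := by
  have : 0 ≤ max (-N) (min u N) := le_max_of_le_right (le_min hu hN)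
  rw [truncPowDeriv, signedPow_of_nonneg hα this]
  positivity

theorem continuous_truncPowDeriv (hα : 0 < α) : Continuous (truncPowDeriv α N) :=
  continuous_const.mul ((continuous_signedPow hα).comp
    (continuous_const.max (continuous_id.min continuous_const)))

theorem truncPowDeriv_le (hα : 0 < α) (hN : 0 ≤ N) (u : ℝ) :
    truncPowDeriv α N u ≤ (1 + α) * N ^ α := by
  rcases le_total 0 u with hu | hu
  · have : 0 ≤ max (-N) (min u N) := le_max_of_le_right (le_min hu hN)
    rw [truncPowDeriv, signedPow_of_nonneg hα this]
    gcongr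
    exact max_le (by linarith) (min_le_right _ _)
  · have h := truncPowDeriv_nonneg hα hN (neg_nonneg.2 hu)
    rw [truncPowDeriv_neg hN] at h
    have : 0 ≤ (1 + α) * N ^ α := by positivity
    linarith

theorem abs_truncPowDeriv_le (hα : 0 < α) (hN : 0 ≤ N) (u : ℝ) :
    |truncPowDeriv α N u| ≤ (1 + α) * N ^ α := by
  refine abs_le'.2 ⟨truncPowDeriv_le hα hN u, ?_⟩
  rw [← truncPowDeriv_neg hN]
  exact truncPowDeriv_le hα hN _

/-- Clipping the argument is 1-Lipschitz, so the Hölder constant does not depend on `N`. -/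
theorem abs_truncPowDeriv_sub_le (hα : 0 < α) (hα' : α ≤ 1) (u v : ℝ) :
    |truncPowDeriv α N u - truncPowDeriv α N v| ≤ (1 + α) * (2 ^ (1 - α) * |u - v| ^ α) := by
  rw [truncPowDeriv, truncPowDeriv, ← mul_sub, abs_mul, abs_of_pos (by linarith : 0 < 1 + α)]
  refine mul_le_mul_of_nonneg_left ((abs_signedPow_sub_le hα hα' _ _).trans ?_) (by linarith)
  refine mul_le_mul_of_nonneg_left
    (Real.rpow_le_rpow (abs_nonneg _) ?_ hα.le) (by positivity)
  have h1 := abs_max_sub_max_le_max (-N) (min u N) (-N) (min v N)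
  have h2 := abs_min_sub_min_le_max u N v N
  simp only [sub_self, abs_zero, abs_nonneg, sup_of_le_right, sup_of_le_left] at h1 h2
  exact h1.trans h2

theorem truncPow_sub (hα : 0 < α) (a b : ℝ) :
    truncPow α N b - truncPow α N a = ∫ u in a..b, truncPowDeriv α N u :=
  intervalIntegral.integral_interval_sub_left
    ((continuous_truncPowDeriv hα).intervalIntegrable _ _)
    ((continuous_truncPowDeriv hα).intervalIntegrable _ _)

theorem truncPow_neg (hN : 0 ≤ N) (s : ℝ) : truncPow α N (-s) = truncPow α N s := by
  have h := intervalIntegral.integral_comp_neg (a := 0) (b := s) (truncPowDeriv α N)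
  simp only [truncPowDeriv_neg hN, intervalIntegral.integral_neg, neg_zero] at h
  rw [intervalIntegral.integral_symm 0 (-s), neg_inj] at h
  exact h.symm

theorem truncPow_abs (hN : 0 ≤ N) (s : ℝ) : truncPow α N |s| = truncPow α N s := by
  rcases abs_choice s with h | h <;> rw [h]
  exact truncPow_neg hN s

theorem truncPow_le_of_abs_le (hα : 0 < α) (hN : 0 ≤ N) {s t : ℝ} (h : |s| ≤ |t|) :
    truncPow α N s ≤ truncPow α N t := by
  rw [← truncPow_abs hN s, ← truncPow_abs hN t, ← sub_nonneg, truncPow_sub hα]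
  exact intervalIntegral.integral_nonneg h fun u hu =>
    truncPowDeriv_nonneg hα hN ((abs_nonneg s).trans hu.1)

theorem lipschitzWith_truncPow (hα : 0 < α) (hN : 0 ≤ N) :
    LipschitzWith (Real.toNNReal ((1 + α) * N ^ α)) (truncPow α N) := by
  refine LipschitzWith.of_dist_le_mul fun s t => ?_
  rw [Real.dist_eq, Real.dist_eq, truncPow_sub hα, Real.coe_toNNReal _ (by positivity),
    ← Real.norm_eq_abs (∫ _ in _.._, _)]
  exact intervalIntegral.norm_integral_le_of_norm_le_const fun u _ => abs_truncPowDeriv_le hα hN u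

/-- A second order Taylor bound with a Hölder continuous derivative. -/
theorem truncPow_add_le (hα : 0 < α) (hα' : α ≤ 1) (hN : 0 ≤ N) (a b : ℝ) :
    truncPow α N (a + b) ≤
      truncPow α N a + truncPowDeriv α N a * b + 2 ^ (1 - α) * |b| ^ (1 + α) := by
  -- `truncPow` is even and its derivative odd.
  wlog hb : 0 ≤ b generalizing a b
  · have h := this (-a) (-b) (by linarith)
    rwa [← neg_add, truncPow_neg hN, truncPow_neg hN, truncPowDeriv_neg hN, neg_mul_neg,
      abs_neg] at h
  have hint : ∫ u in a..a + b, (truncPowDeriv α N a +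
      (1 + α) * (2 ^ (1 - α) * (u - a) ^ α)) =
      truncPowDeriv α N a * b + 2 ^ (1 - α) * |b| ^ (1 + α) := by
    have hc : Continuous fun u : ℝ => (u - a) ^ α :=
      (continuous_id.sub continuous_const).rpow_const fun _ => Or.inr hα.le
    rw [intervalIntegral.integral_add (by simp)
      (((hc.const_mul _).const_mul _).intervalIntegrable _ _),
      intervalIntegral.integral_const, intervalIntegral.integral_const_mul,
      intervalIntegral.integral_const_mul,
      intervalIntegral.integral_comp_sub_right (fun u => u ^ α),
      integral_rpow (Or.inl (by linarith)),
      sub_self, add_sub_cancel_left, Real.zero_rpow (by linarith), abs_of_nonneg hb, smul_eq_mul,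
      add_comm α 1]
    have : 1 + α ≠ 0 := by linarith
    field_simp
    ring
  have h : truncPow α N (a + b) - truncPow α N a ≤ ∫ u in a..a + b, (truncPowDeriv α N a +
      (1 + α) * (2 ^ (1 - α) * (u - a) ^ α)) := by
    rw [truncPow_sub hα]
    refine intervalIntegral.integral_mono_on (by linarith)
      ((continuous_truncPowDeriv hα).intervalIntegrable _ _) ?_ fun u hu => ?_
    · refine Continuous.intervalIntegrable ?_ _ _
      have hc : Continuous fun u : ℝ => (u - a) ^ α :=
        (continuous_id.sub continuous_const).rpow_const fun _ => Or.inr hα.le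
      fun_prop
    · have h1 := (abs_le.1 (abs_truncPowDeriv_sub_le (N := N) hα hα' u a)).2
      rw [abs_of_nonneg (sub_nonneg.2 hu.1)] at h1
      linarith
  linarith

theorem truncPow_self (hα : 0 < α) (hN : 0 ≤ N) : truncPow α N N = N ^ (1 + α) := by
  have h : truncPow α N N = ∫ u in (0 : ℝ)..N, (1 + α) * u ^ α := by
    refine intervalIntegral.integral_congr fun u hu => ?_
    rw [Set.uIcc_of_le hN] at hu
    have hu' : max (-N) (min u N) = u := by
      rw [min_eq_left hu.2, max_eq_right (by linarith [hu.1])]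
    simp only [truncPowDeriv, hu', signedPow_of_nonneg hα hu.1]
  rw [h, intervalIntegral.integral_const_mul, integral_rpow (Or.inl (by linarith)),
    Real.zero_rpow (by linarith), add_comm α 1, sub_zero, mul_div_cancel₀]
  linarith

/-- The left side is the tangent line at `N` in the variable `|s|`: the slope of `truncPow` is at
most `(1 + α) * N ^ α` and equals it beyond `N`. This is what Jensen's argument uses. -/
theorem le_truncPow (hα : 0 < α) (hN : 0 ≤ N) (s : ℝ) :
    N ^ (1 + α) + (1 + α) * N ^ α * (|s| - N) ≤ truncPow α N s := by
  rw [← truncPow_abs hN s, ← truncPow_self hα hN, ← le_sub_iff_add_le', truncPow_sub hα]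
  have hconst : ∀ a b : ℝ, ∫ _ in a..b, (1 + α) * N ^ α = (1 + α) * N ^ α * (b - a) := by
    intro a b
    rw [intervalIntegral.integral_const, smul_eq_mul, mul_comm]
  rcases le_total N |s| with h | h
  · rw [← hconst]
    refine intervalIntegral.integral_mono_on h (by simp)
      ((continuous_truncPowDeriv hα).intervalIntegrable _ _) fun u hu => ?_
    have hu' : max (-N) (min u N) = N := by
      rw [min_eq_right hu.1, max_eq_right (by linarith)]
    rw [truncPowDeriv, hu', signedPow_of_nonneg hα hN]
  · rw [← hconst, intervalIntegral.integral_symm |s|, intervalIntegral.integral_symm |s|]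
    refine neg_le_neg (intervalIntegral.integral_mono_on h
      ((continuous_truncPowDeriv hα).intervalIntegrable _ _) (by simp) fun u _ => ?_)
    exact truncPowDeriv_le hα hN u

end TruncPow

/-! ### The outer expectation on dominated functions -/

namespace SublinearExpectationSpace

variable {Ω : Type*} (S : SublinearExpectationSpace Ω)

/-- `Z` is dominated in absolute value by a member of `H`. On these functions `S.expect` is a
sublinear expectation. -/
def Dominated (Z : Ω → ℝ) : Prop :=
  ∃ W : S.H, ∀ ω, |Z ω| ≤ W.1 ω

variable {S}

theorem Dominated.of_abs_le {Z Z' : Ω → ℝ} (h : S.Dominated Z') (hZ : ∀ ω, |Z ω| ≤ Z' ω) :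
    S.Dominated Z := by
  obtain ⟨W, hW⟩ := h
  exact ⟨W, fun ω => (hZ ω).trans ((le_abs_self _).trans (hW ω))⟩

theorem Dominated.abs {Z : Ω → ℝ} (h : S.Dominated Z) : S.Dominated (fun ω => |Z ω|) := by
  obtain ⟨W, hW⟩ := h
  exact ⟨W, fun ω => by simpa using hW ω⟩

theorem Dominated.neg {Z : Ω → ℝ} (h : S.Dominated Z) : S.Dominated (fun ω => -Z ω) :=
  h.abs.of_abs_le fun ω => by simp

theorem Dominated.add {Z Z' : Ω → ℝ} (h : S.Dominated Z) (h' : S.Dominated Z') :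
    S.Dominated (fun ω => Z ω + Z' ω) := by
  obtain ⟨W, hW⟩ := h
  obtain ⟨W', hW'⟩ := h'
  exact ⟨W + W', fun ω => (abs_add_le _ _).trans (add_le_add (hW ω) (hW' ω))⟩

theorem Dominated.const_mul {Z : Ω → ℝ} (h : S.Dominated Z) (c : ℝ) :
    S.Dominated (fun ω => c * Z ω) := by
  obtain ⟨W, hW⟩ := h
  refine ⟨|c| • W, fun ω => ?_⟩
  rw [abs_mul]
  exact mul_le_mul_of_nonneg_left (hW ω) (abs_nonneg c)

variable (S) in
theorem dominated_const (c : ℝ) : S.Dominated (fun _ => c) :=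
  ⟨⟨_, S.const_mem |c|⟩, fun _ => le_rfl⟩

theorem MemCompletion.dominated {Z : Ω → ℝ} (h : S.MemCompletion Z) : S.Dominated Z := by
  obtain ⟨Y, W, hW, -⟩ := h 1 one_pos
  have hY : S.Dominated Y.1 := ⟨⟨_, S.abs_mem _ Y.2⟩, fun _ => le_rfl⟩
  have hWd : S.Dominated W.1 := ⟨⟨_, S.abs_mem _ W.2⟩, fun _ => le_rfl⟩
  refine (hY.abs.add hWd).of_abs_le fun ω => ?_
  have := abs_sub_abs_le_abs_sub (Z ω) (Y.1 ω)
  linarith [hW ω]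

theorem Dominated.bddBelow {Z : Ω → ℝ} (h : S.Dominated Z) :
    BddBelow {c : ℝ | ∃ Y : S.H, (∀ ω, Z ω ≤ Y.1 ω) ∧ S.E Y = c} := by
  obtain ⟨W, hW⟩ := h
  refine ⟨S.E (-W), ?_⟩
  rintro c ⟨Y, hY, rfl⟩
  exact S.mono _ _ fun ω => (neg_le_of_abs_le (hW ω)).trans (hY ω)

theorem Dominated.expect_le {Z : Ω → ℝ} (h : S.Dominated Z) {Y : S.H}
    (hY : ∀ ω, Z ω ≤ Y.1 ω) : S.expect Z ≤ S.E Y :=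
  csInf_le h.bddBelow ⟨Y, hY, rfl⟩

theorem Dominated.le_expect {Z : Ω → ℝ} (h : S.Dominated Z) {c : ℝ}
    (hc : ∀ Y : S.H, (∀ ω, Z ω ≤ Y.1 ω) → c ≤ S.E Y) : c ≤ S.expect Z := by
  obtain ⟨W, hW⟩ := h
  refine le_csInf ⟨S.E W, W, fun ω => (le_abs_self _).trans (hW ω), rfl⟩ ?_
  rintro c ⟨Y, hY, rfl⟩
  exact hc Y hY

theorem Dominated.exists_lt {Z : Ω → ℝ} (h : S.Dominated Z) {c : ℝ} (hc : S.expect Z < c) :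
    ∃ Y : S.H, (∀ ω, Z ω ≤ Y.1 ω) ∧ S.E Y < c := by
  by_contra! H
  exact hc.not_ge (h.le_expect H)

theorem Dominated.expect_mono {Z Z' : Ω → ℝ} (h : S.Dominated Z) (h' : S.Dominated Z')
    (hle : ∀ ω, Z ω ≤ Z' ω) : S.expect Z ≤ S.expect Z' :=
  h'.le_expect fun _ hY => h.expect_le fun ω => (hle ω).trans (hY ω)

variable (S) in
theorem expect_const (c : ℝ) : S.expect (fun _ => c) = c :=
  (S.expect_coe ⟨_, S.const_mem c⟩).trans (S.const c)

/-- Majorants of `Z` and of `Z'` in `H` add up to a majorant of the sum; take the two infima in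
turn. -/
theorem Dominated.expect_add_le {Z Z' : Ω → ℝ} (h : S.Dominated Z) (h' : S.Dominated Z') :
    S.expect (fun ω => Z ω + Z' ω) ≤ S.expect Z + S.expect Z' := by
  have key : S.expect (fun ω => Z ω + Z' ω) - S.expect Z' ≤ S.expect Z := by
    refine h.le_expect fun Y hY => ?_
    have : S.expect (fun ω => Z ω + Z' ω) - S.E Y ≤ S.expect Z' := by
      refine h'.le_expect fun Y' hY' => ?_
      have h1 := (h.add h').expect_le (Y := Y + Y') fun ω => add_le_add (hY ω) (hY' ω)
      linarith [S.subadd Y Y']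
    linarith
  linarith

theorem Dominated.expect_add_const_le {Z : Ω → ℝ} (h : S.Dominated Z) (c : ℝ) :
    S.expect (fun ω => Z ω + c) ≤ S.expect Z + c := by
  simpa [S.expect_const] using h.expect_add_le (S.dominated_const c)

theorem Dominated.expect_const_mul_le {Z : Ω → ℝ} (h : S.Dominated Z) {c : ℝ} (hc : 0 < c) :
    S.expect (fun ω => c * Z ω) ≤ c * S.expect Z := by
  have key : S.expect (fun ω => c * Z ω) / c ≤ S.expect Z := by
    refine h.le_expect fun Y hY => ?_
    rw [div_le_iff₀' hc, ← S.pos_homog c Y hc.le]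
    exact (h.const_mul c).expect_le fun ω => mul_le_mul_of_nonneg_left (hY ω) hc.le
  rwa [div_le_iff₀' hc] at key

theorem Dominated.expect_const_mul {Z : Ω → ℝ} (h : S.Dominated Z) {c : ℝ} (hc : 0 ≤ c) :
    S.expect (fun ω => c * Z ω) = c * S.expect Z := by
  rcases hc.eq_or_lt with rfl | hc
  · simp [S.expect_const]
  · refine (h.expect_const_mul_le hc).antisymm ?_
    -- The reverse inequality is the same bound for the factor `c⁻¹`.
    have h1 := (h.const_mul c).expect_const_mul_le (inv_pos.2 hc)
    simp only [inv_mul_cancel_left₀ hc.ne'] at h1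
    rwa [inv_mul_eq_div, le_div_iff₀' hc] at h1

theorem Dominated.neg_expect_neg_le {Z : Ω → ℝ} (h : S.Dominated Z) :
    -S.expect (fun ω => -Z ω) ≤ S.expect Z := by
  have := h.expect_add_le h.neg
  simp only [add_neg_cancel, S.expect_const] at this
  linarith

theorem Dominated.le_expect_of_le {Z : Ω → ℝ} (h : S.Dominated Z) {c : ℝ} (hc : ∀ ω, c ≤ Z ω) :
    c ≤ S.expect Z :=
  (S.expect_const c).symm.trans_le ((S.dominated_const c).expect_mono h hc)

theorem Dominated.abs_expect_le {Z : Ω → ℝ} (h : S.Dominated Z) :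
    |S.expect Z| ≤ S.expect (fun ω => |Z ω|) := by
  refine abs_le'.2 ⟨h.expect_mono h.abs fun ω => le_abs_self _, ?_⟩
  have h1 := h.neg.expect_mono h.abs fun ω => neg_le_abs _
  have h2 := h.neg_expect_neg_le
  linarith

theorem Dominated.abs_expect_sub_expect_le {Z Z' W : Ω → ℝ} (h : S.Dominated Z)
    (h' : S.Dominated Z') (hW : S.Dominated W) (hle : ∀ ω, |Z ω - Z' ω| ≤ W ω) :
    |S.expect Z - S.expect Z'| ≤ S.expect W := by
  have h1 := (h.expect_mono (h'.add hW) fun ω => by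
    linarith [(abs_le.1 (hle ω)).2]).trans (h'.expect_add_le hW)
  have h2 := (h'.expect_mono (h.add hW) fun ω => by
    linarith [(abs_le.1 (hle ω)).1]).trans (h.expect_add_le hW)
  rw [abs_le]
  constructor <;> linarith

end SublinearExpectationSpace

/-! ### Clipping Lipschitz functions -/

theorem LipschitzWith.abs_le_add_mul_abs {K : NNReal} {f : ℝ → ℝ} (hf : LipschitzWith K f) (x : ℝ) :
    |f x| ≤ |f 0| + K * |x| := by
  have h := hf.dist_le_mul x 0
  rw [Real.dist_eq, Real.dist_eq, sub_zero] at h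
  linarith [abs_sub_abs_le_abs_sub (f x) (f 0)]

theorem LipschitzWith.abs_sub_le {K : NNReal} {f : ℝ → ℝ} (hf : LipschitzWith K f) (x y : ℝ) :
    |f x - f y| ≤ K * |x - y| := by
  simpa [Real.dist_eq] using hf.dist_le_mul x y

theorem LipschitzWith.clip {E : Type*} [PseudoEMetricSpace E] {K : NNReal} {f : E → ℝ}
    (hf : LipschitzWith K f) (N : ℝ) : LipschitzWith K (fun x => max (-N) (min (f x) N)) :=
  (hf.min_const N).const_max (-N)

theorem abs_clip_le {N : ℝ} (hN : 0 ≤ N) (y : ℝ) : |max (-N) (min y N)| ≤ N :=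
  abs_le.2 ⟨le_max_left _ _, max_le (by linarith) (min_le_right _ _)⟩

/-- The error is zero for `|y| ≤ N`, and otherwise at most `|y| ≤ |y| * (|y| / N) ^ α`. Thus a
moment of order above one makes clipping errors vanish as `N → ∞`. -/
theorem abs_sub_clip_le {α N : ℝ} (hα : 0 ≤ α) (hN : 0 < N) (y : ℝ) :
    |y - max (-N) (min y N)| ≤ |y| ^ (1 + α) / N ^ α := by
  rcases le_total |y| N with h | h
  · obtain ⟨h1, h2⟩ := abs_le.1 h
    rw [min_eq_left h2, max_eq_right h1, sub_self, abs_zero]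
    positivity
  · have hy : 0 < |y| := hN.trans_le h
    have h1 : |y - max (-N) (min y N)| ≤ |y| := by grind
    refine h1.trans ?_
    rw [le_div_iff₀ (by positivity), Real.rpow_add hy, Real.rpow_one]
    gcongr

theorem LipschitzWith.exists_abs_sub_clip_le {K : NNReal} {f : ℝ → ℝ} (hf : LipschitzWith K f)
    {α : ℝ} (hα : 0 ≤ α) :
    ∃ B : ℝ, 0 ≤ B ∧ ∀ N : ℝ, 0 < N → ∀ x : ℝ,
      |f x - max (-N) (min (f x) N)| ≤ B / N ^ α * (1 + |x| ^ (1 + α)) := by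
  refine ⟨2 ^ α * (|f 0| ^ (1 + α) + (K : ℝ) ^ (1 + α)), by positivity, fun N hN x => ?_⟩
  refine (abs_sub_clip_le hα hN _).trans ?_
  rw [div_mul_eq_mul_div]
  gcongr
  refine (Real.rpow_le_rpow (abs_nonneg _) (hf.abs_le_add_mul_abs x) (by linarith)).trans ?_
  refine (Real.add_rpow_one_add_le hα (abs_nonneg _) (by positivity)).trans ?_
  rw [mul_assoc, Real.mul_rpow K.coe_nonneg (abs_nonneg x)]
  gcongr
  have h1 : 0 ≤ |f 0| ^ (1 + α) := by positivity
  have h2 : 0 ≤ (K : ℝ) ^ (1 + α) := Real.rpow_nonneg K.coe_nonneg _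
  have h3 : 0 ≤ |x| ^ (1 + α) := by positivity
  nlinarith [mul_nonneg h1 h3]

theorem isBoundedLipschitz_clip_sum {K : NNReal} {f : ℝ → ℝ} (hf : LipschitzWith K f) (n : ℕ)
    {N : ℝ} (hN : 0 ≤ N) :
    IsBoundedLipschitz (fun v : Fin n → ℝ => max (-N) (min (f (∑ i, v i)) N)) := by
  refine ⟨⟨K * n, ?_⟩, N, fun v => abs_clip_le hN _⟩
  have hsum : LipschitzWith n (fun v : Fin n → ℝ => ∑ i, v i) := by
    refine LipschitzWith.of_dist_le_mul fun v w => ?_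
    refine (dist_sum_sum_le _ _ _).trans ?_
    refine (Finset.sum_le_card_nsmul _ _ (dist v w) fun i _ => dist_le_pi_dist v w i).trans ?_
    simp
  exact (hf.comp hsum).clip N

/-! ### From bounded to unbounded Lipschitz functions of partial sums -/

namespace SublinearExpectationSpace

variable {Ω : Type*} {S : SublinearExpectationSpace Ω}

theorem Dominated.comp_lipschitz {Z : Ω → ℝ} (hZ : S.Dominated Z) {K : NNReal} {f : ℝ → ℝ}
    (hf : LipschitzWith K f) : S.Dominated (fun ω => f (Z ω)) :=
  ((S.dominated_const |f 0|).add (hZ.abs.const_mul K)).of_abs_le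
    fun ω => hf.abs_le_add_mul_abs (Z ω)

theorem Dominated.sum {ι : Type*} (s : Finset ι) {Z : ι → Ω → ℝ} (hZ : ∀ i, S.Dominated (Z i)) :
    S.Dominated (fun ω => ∑ i ∈ s, Z i ω) := by
  classical
  induction s using Finset.induction_on with
  | empty => simpa using S.dominated_const 0
  | insert a s ha ih => simpa only [Finset.sum_insert ha] using (hZ a).add ih

theorem Dominated.abs_rpow_add {α : ℝ} (hα : 0 ≤ α) {Z Z' : Ω → ℝ}
    (h : S.Dominated (fun ω => |Z ω| ^ (1 + α))) (h' : S.Dominated (fun ω => |Z' ω| ^ (1 + α))) :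
    S.Dominated (fun ω => |Z ω + Z' ω| ^ (1 + α)) :=
  ((h.add h').const_mul (2 ^ α)).of_abs_le fun ω => by
    rw [abs_of_nonneg (by positivity)]
    exact Real.abs_add_rpow_one_add_le hα _ _

theorem Dominated.abs_rpow_sum {ι : Type*} (s : Finset ι) {α : ℝ} (hα : 0 ≤ α) {Z : ι → Ω → ℝ}
    (hZ : ∀ i, S.Dominated (fun ω => |Z i ω| ^ (1 + α))) :
    S.Dominated (fun ω => |∑ i ∈ s, Z i ω| ^ (1 + α)) := by
  classical
  induction s using Finset.induction_on with
  | empty => simpa using S.dominated_const (0 ^ (1 + α))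
  | insert a s ha ih => simpa only [Finset.sum_insert ha] using (hZ a).abs_rpow_add hα ih

theorem Dominated.expect_nonneg {Z : Ω → ℝ} (h : S.Dominated Z) (h0 : ∀ ω, 0 ≤ Z ω) :
    0 ≤ S.expect Z :=
  h.le_expect_of_le h0

/-- The inner expectation grows at most linearly in `|T ω|`. Domination is all that is needed to
apply the outer expectation, so membership in the completion is not checked. -/
theorem Dominated.expect_lipschitz_add {T Y : Ω → ℝ} (hT : S.Dominated T) (hY : S.Dominated Y)
    {K : NNReal} {g : ℝ → ℝ} (hg : LipschitzWith K g) :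
    S.Dominated (fun ω => S.expect (fun ω' => g (T ω + Y ω'))) := by
  refine (((hT.abs.const_mul K).add
    (S.dominated_const (|g 0| + K * S.expect (fun ω' => |Y ω'|))))).of_abs_le fun ω => ?_
  have hd := ((S.dominated_const (T ω)).add hY).comp_lipschitz hg
  refine hd.abs_expect_le.trans ?_
  have h1 : ∀ ω', |g (T ω + Y ω')| ≤ K * |Y ω'| + (|g 0| + K * |T ω|) := fun ω' => by
    have := hg.abs_le_add_mul_abs (T ω + Y ω')
    have h2 : (K : ℝ) * |T ω + Y ω'| ≤ K * (|T ω| + |Y ω'|) := by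
      gcongr
      exact abs_add_le _ _
    linarith
  have h2 := hd.abs.expect_mono ((hY.abs.const_mul K).add (S.dominated_const _)) h1
  have h3 := (hY.abs.const_mul K).expect_add_const_le (|g 0| + K * |T ω|)
  rw [hY.abs.expect_const_mul K.coe_nonneg] at h3
  linarith [h2.trans h3]

theorem eq_of_abs_sub_le_div_rpow {a b K α : ℝ} (hα : 0 < α)
    (h : ∀ N : ℝ, 0 < N → |a - b| ≤ K / N ^ α) : a = b := by
  have hlim : Filter.Tendsto (fun N : ℝ => K / N ^ α) Filter.atTop (nhds 0) :=
    (tendsto_rpow_atTop hα).const_div_atTop K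
  have h0 : |a - b| ≤ 0 := ge_of_tendsto hlim
    ((Filter.eventually_gt_atTop 0).mono fun N hN => h N hN)
  exact sub_eq_zero.1 (abs_nonpos_iff.1 h0)

/-- Independence, for Lipschitz functions of the partial sums that need not be bounded. -/
theorem Independent.expect_lipschitz_sum_succ {X : ℕ → Ω → ℝ} (hind : S.Independent X)
    (hX : ∀ i, S.Dominated (X i)) {α : ℝ} (hα : 0 < α)
    (hXp : ∀ i, S.Dominated (fun ω => |X i ω| ^ (1 + α))) {K : NNReal} {f : ℝ → ℝ}
    (hf : LipschitzWith K f) (n : ℕ) :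
    S.expect (fun ω => f (∑ i ∈ Finset.range (n + 1), X i ω)) =
      S.expect (fun ω => S.expect (fun ω' => f (∑ i ∈ Finset.range n, X i ω + X n ω'))) := by
  obtain ⟨B, hB, hclip⟩ := hf.exists_abs_sub_clip_le hα.le
  set T : Ω → ℝ := fun ω => ∑ i ∈ Finset.range n, X i ω with hT
  set T' : Ω → ℝ := fun ω => ∑ i ∈ Finset.range (n + 1), X i ω with hT'
  have hTd : S.Dominated T := Dominated.sum _ hX
  have hTd' : S.Dominated T' := Dominated.sum _ hX
  have hTp : S.Dominated (fun ω => |T ω| ^ (1 + α)) := Dominated.abs_rpow_sum _ hα.le hXp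
  have hTp' : S.Dominated (fun ω => |T' ω| ^ (1 + α)) := Dominated.abs_rpow_sum _ hα.le hXp
  have hshift : ∀ x, S.Dominated (fun ω' => x + X n ω') := fun x => (S.dominated_const x).add (hX n)
  set m := S.expect (fun ω => |X n ω| ^ (1 + α)) with hm
  set W' : Ω → ℝ := fun ω => 1 + |T' ω| ^ (1 + α) with hW'
  -- Bounds the inner expectation of `1 + |T ω + X n| ^ (1 + α)` with `T ω` frozen.
  set W : Ω → ℝ := fun ω => 2 ^ α * |T ω| ^ (1 + α) + (2 ^ α * m + 1) with hW
  have hWd' : S.Dominated W' := (S.dominated_const 1).add hTp'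
  have hWd : S.Dominated W := (hTp.const_mul _).add (S.dominated_const _)
  refine eq_of_abs_sub_le_div_rpow (K := B * (S.expect W' + S.expect W)) hα fun N hN => ?_
  set g : ℝ → ℝ := fun x => max (-N) (min (f x) N) with hg
  have hgl : LipschitzWith K g := hf.clip N
  have hBN : 0 ≤ B / N ^ α := by positivity
  have hkey : S.expect (fun ω => g (T' ω)) =
      S.expect (fun ω => S.expect (fun ω' => g (T ω + X n ω'))) := by
    have h := hind n _ (isBoundedLipschitz_clip_sum hf (n + 1) hN.le)
    simp only [Fin.sum_univ_castSucc, Fin.snoc_castSucc, Fin.snoc_last] at h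
    simp only [hg, hT', hT, Finset.sum_range_succ]
    have hs : ∀ ω, ∑ i : Fin n, X i ω = ∑ i ∈ Finset.range n, X i ω :=
      fun ω => Fin.sum_univ_eq_sum_range (fun i => X i ω) n
    simpa only [Fin.val_castSucc, Fin.val_last, hs] using h
  have hleft : |S.expect (fun ω => f (T' ω)) - S.expect (fun ω => g (T' ω))| ≤
      B / N ^ α * S.expect W' := by
    rw [← hWd'.expect_const_mul hBN]
    exact (hTd'.comp_lipschitz hf).abs_expect_sub_expect_le (hTd'.comp_lipschitz hgl)
      (hWd'.const_mul _) fun ω => hclip N hN _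
  have hright : |S.expect (fun ω => S.expect (fun ω' => f (T ω + X n ω'))) -
      S.expect (fun ω => S.expect (fun ω' => g (T ω + X n ω')))| ≤ B / N ^ α * S.expect W := by
    rw [← hWd.expect_const_mul hBN]
    refine (hTd.expect_lipschitz_add (hX n) hf).abs_expect_sub_expect_le
      (hTd.expect_lipschitz_add (hX n) hgl) (hWd.const_mul _) fun ω => ?_
    have hV : S.Dominated
        (fun ω' => 2 ^ α * |X n ω'| ^ (1 + α) + (2 ^ α * |T ω| ^ (1 + α) + 1)) :=
      ((hXp n).const_mul _).add (S.dominated_const _)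
    refine (((hshift (T ω)).comp_lipschitz hf).abs_expect_sub_expect_le
      ((hshift (T ω)).comp_lipschitz hgl) (hV.const_mul (B / N ^ α)) fun ω' => ?_).trans ?_
    · refine (hclip N hN _).trans (mul_le_mul_of_nonneg_left ?_ hBN)
      have := Real.abs_add_rpow_one_add_le hα.le (T ω) (X n ω')
      linarith
    · rw [hV.expect_const_mul hBN]
      refine mul_le_mul_of_nonneg_left ?_ hBN
      have h3 := ((hXp n).const_mul (2 ^ α)).expect_add_const_le (2 ^ α * |T ω| ^ (1 + α) + 1)
      rw [(hXp n).expect_const_mul (by positivity)] at h3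
      refine h3.trans (le_of_eq ?_)
      rw [hW, hm]
      ring
  rw [← hkey] at hright
  rw [abs_sub_comm] at hright
  have h := abs_sub_le (S.expect (fun ω => f (T' ω))) (S.expect (fun ω => g (T' ω)))
    (S.expect (fun ω => S.expect (fun ω' => f (T ω + X n ω'))))
  refine (h.trans (add_le_add hleft hright)).trans (le_of_eq ?_)
  ring

/-- Lipschitz functions of partial sums stay in the completion when the summands have a finite
moment of order larger than one. -/
theorem memCompletion_lipschitz_sum {X : ℕ → Ω → ℝ} (hX : ∀ i, S.MemCompletion (X i)) {α : ℝ}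
    (hα : 0 < α) (hXp : ∀ i, S.Dominated (fun ω => |X i ω| ^ (1 + α))) {K : NNReal} {f : ℝ → ℝ}
    (hf : LipschitzWith K f) (n : ℕ) :
    S.MemCompletion (fun ω => f (∑ i ∈ Finset.range n, X i ω)) := by
  intro ε hε
  obtain ⟨B, hB, hclip⟩ := hf.exists_abs_sub_clip_le hα.le
  have hWd : S.Dominated (fun ω => 1 + |∑ i ∈ Finset.range n, X i ω| ^ (1 + α)) :=
    (S.dominated_const 1).add (Dominated.abs_rpow_sum _ hα.le hXp)
  obtain ⟨N, hN, hNε⟩ : ∃ N : ℝ, 0 < N ∧ B / N ^ α *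
      S.expect (fun ω => 1 + |∑ i ∈ Finset.range n, X i ω| ^ (1 + α)) < ε / 2 := by
    have hlim : Filter.Tendsto (fun N : ℝ => B / N ^ α *
        S.expect (fun ω => 1 + |∑ i ∈ Finset.range n, X i ω| ^ (1 + α)))
        Filter.atTop (nhds (0 * _)) :=
      ((tendsto_rpow_atTop hα).const_div_atTop B).mul_const _
    rw [zero_mul] at hlim
    exact ((Filter.eventually_gt_atTop 0).and
      (hlim.eventually_lt_const (half_pos hε))).exists
  rw [← hWd.expect_const_mul (by positivity)] at hNε
  obtain ⟨V, hV, hVε⟩ := (hWd.const_mul _).exists_lt hNε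
  -- The `n` replacements cost `K * n * δ ≤ ε / 2`; the `+ 1` keeps the denominator positive.
  set δ : ℝ := ε / 2 / (K * n + 1) with hδ
  have hKn : (0 : ℝ) < K * n + 1 := by positivity
  choose Y W hYW hWδ using fun i => hX i δ (by positivity)
  let U : S.H := ⟨_, S.comp_mem n (fun i => (Y i).1) (fun i => (Y i).2) _
    (isBoundedLipschitz_clip_sum hf n hN.le)⟩
  -- `V` pays for clipping `f`, the sum for replacing each `X i` by `Y i` inside the clipped
  -- function.
  refine ⟨U, V + (K : ℝ) • ∑ i ∈ Finset.range n, W i, fun ω => ?_, ?_⟩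
  · have h1 := (hclip N hN (∑ i ∈ Finset.range n, X i ω)).trans (hV ω)
    have h2 := (hf.clip N).abs_sub_le (∑ i ∈ Finset.range n, X i ω)
      (∑ i ∈ Finset.range n, (Y i).1 ω)
    have h3 : |∑ i ∈ Finset.range n, X i ω - ∑ i ∈ Finset.range n, (Y i).1 ω| ≤
        ∑ i ∈ Finset.range n, (W i).1 ω := by
      rw [← Finset.sum_sub_distrib]
      exact (Finset.abs_sum_le_sum_abs _ _).trans (Finset.sum_le_sum fun i _ => hYW i ω)
    have hU : U.1 ω = max (-N) (min (f (∑ i ∈ Finset.range n, (Y i).1 ω)) N) := by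
      simp only [U, Fin.sum_univ_eq_sum_range (fun i => (Y i).1 ω)]
    have hR : (V + (K : ℝ) • ∑ i ∈ Finset.range n, W i).1 ω =
        V.1 ω + K * ∑ i ∈ Finset.range n, (W i).1 ω := by
      simp
    rw [hU, hR]
    refine (abs_sub_le _ _ _).trans (add_le_add h1 (h2.trans ?_))
    gcongr
  · have hsum : ∀ k, S.E (∑ i ∈ Finset.range k, W i) ≤ k * δ := by
      intro k
      induction k with
      | zero => simpa using (show S.E 0 = 0 from S.const 0).le
      | succ k ih =>
        rw [Finset.sum_range_succ]
        refine (S.subadd _ _).trans ?_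
        push_cast
        linarith [hWδ k]
    have h1 := S.subadd V ((K : ℝ) • ∑ i ∈ Finset.range n, W i)
    rw [S.pos_homog _ _ K.coe_nonneg] at h1
    have h2 : (K : ℝ) * S.E (∑ i ∈ Finset.range n, W i) ≤ K * (n * δ) := by
      gcongr
      exact hsum n
    have h3 : (K * n + 1) * δ = ε / 2 := by
      rw [hδ]
      field_simp
    have hδ0 : 0 < δ := by positivity
    linarith

end SublinearExpectationSpace

/-! ### Jensen's inequality and the one-step moment bounds -/

namespace SublinearExpectationSpace

variable {Ω : Type*} {S : SublinearExpectationSpace Ω} {α : ℝ}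

/-- Jensen's argument with a single tangent line: take expectations in `hle` and divide by the
slope. `Z` may be the power of `|Y|` or its truncation at `t`. -/
theorem Dominated.expect_abs_le_of_tangent_le {Y Z : Ω → ℝ} (hα : 0 < α) (hY : S.Dominated Y)
    (hZ : S.Dominated Z) {t : ℝ} (ht : 0 < t)
    (hle : ∀ ω, t ^ (1 + α) + (1 + α) * t ^ α * (|Y ω| - t) ≤ Z ω)
    (hE : S.expect Z ≤ t ^ (1 + α)) : S.expect (fun ω => |Y ω|) ≤ t := by
  have hc : 0 < (1 + α) * t ^ α := by positivity
  have h1 := (hY.abs.const_mul ((1 + α) * t ^ α)).expect_mono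
    (hZ.add (S.dominated_const ((1 + α) * t ^ α * t - t ^ (1 + α)))) fun ω => by linarith [hle ω]
  rw [hY.abs.expect_const_mul hc.le] at h1
  have h2 := hZ.expect_add_const_le ((1 + α) * t ^ α * t - t ^ (1 + α))
  exact le_of_mul_le_mul_left (by linarith) hc

/-- The same argument for the lower expectation `-Ê[-·]`. -/
theorem Dominated.neg_expect_neg_abs_le_of_tangent_le {Y Z : Ω → ℝ} (hα : 0 < α)
    (hY : S.Dominated Y) (hZ : S.Dominated Z) {t : ℝ} (ht : 0 < t)
    (hle : ∀ ω, t ^ (1 + α) + (1 + α) * t ^ α * (|Y ω| - t) ≤ Z ω)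
    (hE : -t ^ (1 + α) ≤ S.expect (fun ω => -Z ω)) : -t ≤ S.expect (fun ω => -|Y ω|) := by
  have hc : 0 < (1 + α) * t ^ α := by positivity
  have h1 := hZ.neg.expect_mono ((hY.abs.neg.const_mul ((1 + α) * t ^ α)).add
    (S.dominated_const ((1 + α) * t ^ α * t - t ^ (1 + α)))) fun ω => by linarith [hle ω]
  have h2 := (hY.abs.neg.const_mul ((1 + α) * t ^ α)).expect_add_const_le
    ((1 + α) * t ^ α * t - t ^ (1 + α))
  rw [hY.abs.neg.expect_const_mul hc.le] at h2
  exact le_of_mul_le_mul_left (by linarith) hc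

/-- Letting `t` decrease to `C ^ p⁻¹` also covers `C = 0`, where the tangent at `0` would have no
slope to divide by. -/
theorem le_rpow_inv_of_forall {p a C : ℝ} (hp : 0 < p) (hC : 0 ≤ C)
    (h : ∀ t, 0 < t → C ≤ t ^ p → a ≤ t) : a ≤ C ^ p⁻¹ := by
  refine le_of_forall_gt_imp_ge_of_dense fun t ht => ?_
  have ht0 : 0 < t := (Real.rpow_nonneg hC _).trans_lt ht
  exact h t ht0 ((Real.rpow_inv_lt_iff_of_pos hC ht0.le hp).1 ht).le

/-- Jensen's inequality for `x ↦ x ^ (1 + α)`. -/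
theorem Dominated.expect_abs_rpow_le {Y : Ω → ℝ} (hα : 0 < α) (hY : S.Dominated Y)
    (hYp : S.Dominated (fun ω => |Y ω| ^ (1 + α))) {C : ℝ}
    (hC : S.expect (fun ω => |Y ω| ^ (1 + α)) ≤ C) :
    S.expect (fun ω => |Y ω|) ^ (1 + α) ≤ C := by
  have hp : 0 < 1 + α := by linarith
  have hC0 : 0 ≤ C := (hYp.expect_nonneg fun ω => by positivity).trans hC
  refine (Real.le_rpow_inv_iff_of_pos (hY.abs.expect_nonneg fun ω => abs_nonneg _) hC0 hp).1 ?_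
  exact le_rpow_inv_of_forall hp hC0 fun t ht htC =>
    hY.expect_abs_le_of_tangent_le hα hYp ht
      (fun ω => Real.tangent_le_rpow_one_add hα.le (abs_nonneg _) ht) (hC.trans htC)

theorem Dominated.abs_sub_rpow {Y : Ω → ℝ} (hα : 0 ≤ α)
    (hYp : S.Dominated (fun ω => |Y ω| ^ (1 + α))) (m : ℝ) :
    S.Dominated (fun ω => |Y ω - m| ^ (1 + α)) := by
  simpa only [sub_eq_add_neg] using hYp.abs_rpow_add hα (S.dominated_const (|-m| ^ (1 + α)))

theorem Dominated.sub_const {Y : Ω → ℝ} (hY : S.Dominated Y) (m : ℝ) :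
    S.Dominated (fun ω => Y ω - m) := by
  simpa only [sub_eq_add_neg] using hY.add (S.dominated_const (-m))

/-- The centered moment around a point between the lower and the upper mean. -/
theorem Dominated.expect_abs_sub_rpow_le {Y : Ω → ℝ} (hα : 0 < α) (hY : S.Dominated Y)
    (hYp : S.Dominated (fun ω => |Y ω| ^ (1 + α))) {C m : ℝ}
    (hC : S.expect (fun ω => |Y ω| ^ (1 + α)) ≤ C)
    (hm : -S.expect (fun ω => -Y ω) ≤ m) (hm' : m ≤ S.expect Y) :
    S.expect (fun ω => |Y ω - m| ^ (1 + α)) ≤ 2 ^ α * (2 * C) := by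
  -- `|m| ≤ Ê[|Y|]` because `m` lies between the means; then Jensen.
  have hmC : |m| ^ (1 + α) ≤ C := by
    refine le_trans ?_ (hY.expect_abs_rpow_le hα hYp hC)
    refine Real.rpow_le_rpow (abs_nonneg _) ?_ (by linarith)
    have h1 := (abs_le.1 hY.neg.abs_expect_le).2
    have h2 := (abs_le.1 hY.abs_expect_le).2
    simp only [abs_neg] at h1
    exact abs_le.2 ⟨by linarith, by linarith⟩
  have hd : S.Dominated (fun ω => |Y ω - m| ^ (1 + α)) := hYp.abs_sub_rpow hα.le m
  have hd' : S.Dominated (fun ω => |Y ω| ^ (1 + α) + |m| ^ (1 + α)) :=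
    hYp.add (S.dominated_const _)
  have h1 := hd.expect_mono (hd'.const_mul (2 ^ α)) fun ω => by
    have := Real.abs_add_rpow_one_add_le hα.le (Y ω) (-m)
    rwa [abs_neg, ← sub_eq_add_neg] at this
  rw [hd'.expect_const_mul (by positivity)] at h1
  refine h1.trans (mul_le_mul_of_nonneg_left ?_ (by positivity))
  linarith [hYp.expect_add_const_le (|m| ^ (1 + α))]

/-- Taylor remainder constant times centered moment bound: the origin of the constant `4`. -/
theorem two_rpow_one_sub_mul (C : ℝ) : (2 : ℝ) ^ (1 - α) * (2 ^ α * (2 * C)) = 4 * C := by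
  rw [← mul_assoc, ← Real.rpow_add two_pos, sub_add_cancel, Real.rpow_one]
  ring

/-- Choosing the mean by the sign of `d` gives the linear Taylor term nonpositive upper expectation:
the slope at `d` has the sign of `d`. -/
theorem Dominated.expect_truncPow_add_le {Y : Ω → ℝ} (hα : 0 < α) (hα' : α ≤ 1)
    (hY : S.Dominated Y) (hYp : S.Dominated (fun ω => |Y ω| ^ (1 + α))) {C m : ℝ}
    (hC : S.expect (fun ω => |Y ω| ^ (1 + α)) ≤ C) {N : ℝ} (hN : 0 ≤ N) (d : ℝ)
    (hm : 0 ≤ d ∧ m = S.expect Y ∨ d ≤ 0 ∧ m = -S.expect (fun ω => -Y ω)) :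
    S.expect (fun ω => truncPow α N (d + (Y ω - m))) ≤ truncPow α N d + 4 * C := by
  have hlu := hY.neg_expect_neg_le
  have hmom := hY.expect_abs_sub_rpow_le hα hYp hC (m := m)
    (by rcases hm with h | h <;> linarith) (by rcases hm with h | h <;> linarith)
  have hYm := hY.sub_const m
  have hYmp := hYp.abs_sub_rpow hα.le m
  have hlin : S.expect (fun ω => truncPowDeriv α N d * (Y ω - m)) ≤ 0 := by
    rcases hm with ⟨hd, rfl⟩ | ⟨hd, rfl⟩
    · have hc := truncPowDeriv_nonneg hα hN hd
      rw [hYm.expect_const_mul hc]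
      refine mul_nonpos_of_nonneg_of_nonpos hc ?_
      have := hY.expect_add_const_le (-S.expect Y)
      simp only [← sub_eq_add_neg, sub_self] at this
      exact this
    · have hc := truncPowDeriv_nonneg hα hN (neg_nonneg.2 hd)
      rw [truncPowDeriv_neg hN] at hc
      have h1 := hYm.neg.expect_const_mul hc
      simp only [neg_mul_neg] at h1
      rw [h1]
      refine mul_nonpos_of_nonneg_of_nonpos hc ?_
      have := hY.neg.expect_add_const_le (-S.expect (fun ω => -Y ω))
      rw [add_neg_cancel] at this
      simpa only [sub_neg_eq_add, neg_add] using this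
  have hK := hYmp.const_mul (2 ^ (1 - α))
  have hL := hYm.const_mul (truncPowDeriv α N d)
  have h1 := (((S.dominated_const d).add hYm).comp_lipschitz
    (lipschitzWith_truncPow hα hN)).expect_mono ((hL.add hK).add
      (S.dominated_const (truncPow α N d))) fun ω => by
        linarith [truncPow_add_le hα hα' hN d (Y ω - m)]
  have h2 := (hL.add hK).expect_add_const_le (truncPow α N d)
  have h3 := hL.expect_add_le hK
  rw [hYmp.expect_const_mul (by positivity)] at h3
  have h4 := mul_le_mul_of_nonneg_left hmom (by positivity : (0 : ℝ) ≤ 2 ^ (1 - α))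
  rw [two_rpow_one_sub_mul] at h4
  linarith

/-- For `r` between the means, `Y - r` and `r - Y` both have nonnegative upper expectation, so the
negated linear Taylor term does too, whatever the sign of `d`. -/
theorem Dominated.le_expect_neg_truncPow_add {Y : Ω → ℝ} (hα : 0 < α) (hα' : α ≤ 1)
    (hY : S.Dominated Y) (hYp : S.Dominated (fun ω => |Y ω| ^ (1 + α))) {C r : ℝ}
    (hC : S.expect (fun ω => |Y ω| ^ (1 + α)) ≤ C) {N : ℝ} (hN : 0 ≤ N) (d : ℝ)
    (hr : -S.expect (fun ω => -Y ω) ≤ r) (hr' : r ≤ S.expect Y) :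
    -truncPow α N d - 4 * C ≤ S.expect (fun ω => -truncPow α N (d + (Y ω - r))) := by
  have hmom := hY.expect_abs_sub_rpow_le hα hYp hC hr hr'
  have hYm := hY.sub_const r
  have hYmp := hYp.abs_sub_rpow hα.le r
  have hlin : 0 ≤ S.expect (fun ω => truncPowDeriv α N d * -(Y ω - r)) := by
    rcases le_total 0 d with hd | hd
    · have hc := truncPowDeriv_nonneg hα hN hd
      rw [hYm.neg.expect_const_mul hc]
      refine mul_nonneg hc ?_
      have := hYm.neg.expect_add_const_le (-r)
      simp only [neg_sub, sub_add_eq_add_sub, add_neg_cancel, zero_sub] at this ⊢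
      linarith
    · have hc := truncPowDeriv_nonneg hα hN (neg_nonneg.2 hd)
      rw [truncPowDeriv_neg hN] at hc
      have h1 := hYm.expect_const_mul hc
      simp only [neg_mul, ← mul_neg] at h1
      rw [h1]
      rw [mul_neg, ← neg_mul]
      refine mul_nonneg hc ?_
      have := hYm.expect_add_const_le r
      simp only [sub_add_cancel] at this
      linarith
  have hK := hYmp.const_mul (2 ^ (1 - α))
  have hL := hYm.neg.const_mul (truncPowDeriv α N d)
  have hh := (((S.dominated_const d).add hYm).comp_lipschitz (lipschitzWith_truncPow hα hN)).neg
  have h1 := hL.expect_mono ((hh.add hK).add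
      (S.dominated_const (truncPow α N d))) fun ω => by
        linarith [truncPow_add_le hα hα' hN d (Y ω - r)]
  have h2 := (hh.add hK).expect_add_const_le (truncPow α N d)
  have h3 := hh.expect_add_le hK
  rw [hYmp.expect_const_mul (by positivity)] at h3
  have h4 := mul_le_mul_of_nonneg_left hmom (by positivity : (0 : ℝ) ≤ 2 ^ (1 - α))
  rw [two_rpow_one_sub_mul] at h4
  linarith

/-- The signed distance of `x` from the interval `[a, b]`. -/
def clampDev (a b x : ℝ) : ℝ := x - max a (min x b)

theorem lipschitzWith_clampDev (a b : ℝ) : LipschitzWith (1 + 1) (clampDev a b) :=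
  LipschitzWith.id.sub ((LipschitzWith.id.min_const b).const_max a)

/-- If `p` is the point of `[a, b]` nearest to `x`, then `p + m` lies in `[a + c, b + d]`, so the
distance of `x + y` from that interval is at most `|x + y - (p + m)|`. -/
theorem abs_clampDev_add_le {a b c d x y m : ℝ} (hab : a ≤ b) (hc : c ≤ m) (hd : m ≤ d) :
    |clampDev (a + c) (b + d) (x + y)| ≤ |clampDev a b x + (y - m)| := by
  unfold clampDev
  grind

/-! ### Moment bounds for partial sums, by induction on `n` -/

section Sums

variable {X : ℕ → Ω → ℝ} {C : ℝ}

theorem Independent.expect_truncPow_clampDev_sum_le (hind : S.Independent X)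
    (hX : ∀ i, S.Dominated (X i)) (hα : 0 < α) (hα' : α ≤ 1)
    (hXp : ∀ i, S.Dominated (fun ω => |X i ω| ^ (1 + α)))
    (hC : ∀ i, S.expect (fun ω => |X i ω| ^ (1 + α)) ≤ C) {μl μu : ℝ}
    (hμu : ∀ i, S.expect (X i) = μu) (hμl : ∀ i, -S.expect (fun ω => -X i ω) = μl)
    {N : ℝ} (hN : 0 ≤ N) (n : ℕ) :
    S.expect (fun ω => truncPow α N
      (clampDev (n * μl) (n * μu) (∑ i ∈ Finset.range n, X i ω))) ≤ n * (4 * C) := by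
  have hlu : μl ≤ μu := by
    rw [← hμu 0, ← hμl 0]
    exact (hX 0).neg_expect_neg_le
  induction n with
  | zero => simp [clampDev, truncPow_zero, S.expect_const]
  | succ n ih =>
    have hab : n * μl ≤ n * μu := by gcongr
    have hlip : ∀ a b, LipschitzWith _ (fun x => truncPow α N (clampDev a b x)) :=
      fun a b => (lipschitzWith_truncPow hα hN).comp (lipschitzWith_clampDev a b)
    have hsum : S.Dominated (fun ω => ∑ i ∈ Finset.range n, X i ω) := Dominated.sum _ hX
    rw [hind.expect_lipschitz_sum_succ hX hα hXp (hlip _ _)]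
    have hstep : ∀ x, S.expect (fun ω' => truncPow α N
        (clampDev ((n + 1 : ℕ) * μl) ((n + 1 : ℕ) * μu) (x + X n ω'))) ≤
        truncPow α N (clampDev (n * μl) (n * μu) x) + 4 * C := by
      intro x
      -- The compensator `m` depends on the past `x`, which is frozen in the inner expectation.
      obtain ⟨m, hm, hml, hmu⟩ : ∃ m,
          (0 ≤ clampDev (n * μl) (n * μu) x ∧ m = S.expect (X n) ∨
            clampDev (n * μl) (n * μu) x ≤ 0 ∧ m = -S.expect (fun ω => -X n ω)) ∧
          μl ≤ m ∧ m ≤ μu := by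
        rcases le_total 0 (clampDev (n * μl) (n * μu) x) with h | h
        · exact ⟨_, Or.inl ⟨h, rfl⟩, by rwa [hμu], (hμu n).le⟩
        · exact ⟨_, Or.inr ⟨h, rfl⟩, (hμl n).ge, by rwa [hμl]⟩
      refine le_trans ?_ ((hX n).expect_truncPow_add_le hα hα' (hXp n) (hC n) hN _ hm)
      have hd : S.Dominated (fun ω' => clampDev (n * μl) (n * μu) x + (X n ω' - m)) :=
        (S.dominated_const _).add ((hX n).sub_const m)
      refine (((S.dominated_const x).add (hX n)).comp_lipschitz (hlip _ _)).expect_mono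
        (hd.comp_lipschitz (lipschitzWith_truncPow hα hN))
        fun ω' => truncPow_le_of_abs_le hα hN ?_
      push_cast
      rw [add_one_mul, add_one_mul]
      exact abs_clampDev_add_le hab hml hmu
    have h1 := (hsum.expect_lipschitz_add (hX n) (hlip _ _)).expect_mono
      ((hsum.comp_lipschitz (hlip _ _)).add (S.dominated_const (4 * C))) fun ω => hstep _
    have h2 := (hsum.comp_lipschitz (hlip (n * μl) (n * μu))).expect_add_const_le (4 * C)
    push_cast at h1 ⊢
    linarith

theorem Independent.le_expect_neg_truncPow_sum (hind : S.Independent X)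
    (hX : ∀ i, S.Dominated (X i)) (hα : 0 < α) (hα' : α ≤ 1)
    (hXp : ∀ i, S.Dominated (fun ω => |X i ω| ^ (1 + α)))
    (hC : ∀ i, S.expect (fun ω => |X i ω| ^ (1 + α)) ≤ C) {r : ℝ}
    (hr' : ∀ i, r ≤ S.expect (X i)) (hr : ∀ i, -S.expect (fun ω => -X i ω) ≤ r)
    {N : ℝ} (hN : 0 ≤ N) (n : ℕ) :
    -(n * (4 * C)) ≤
      S.expect (fun ω => -truncPow α N (∑ i ∈ Finset.range n, X i ω - n * r)) := by
  induction n with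
  | zero => simp [truncPow_zero, S.expect_const]
  | succ n ih =>
    have hlip : ∀ a : ℝ, LipschitzWith _ (fun x => -truncPow α N (x - a)) :=
      fun a => ((lipschitzWith_truncPow hα hN).comp
        (LipschitzWith.id.sub (LipschitzWith.const a))).neg
    have hsum : S.Dominated (fun ω => ∑ i ∈ Finset.range n, X i ω) := Dominated.sum _ hX
    have hstep : ∀ x, -truncPow α N (x - n * r) ≤
        S.expect (fun ω' => -truncPow α N (x + X n ω' - (n + 1 : ℕ) * r)) + 4 * C := by
      intro x
      have h := (hX n).le_expect_neg_truncPow_add hα hα' (hXp n) (hC n) hN (x - n * r)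
        (hr n) (hr' n)
      have heq : ∀ ω', x + X n ω' - (n + 1 : ℕ) * r = x - n * r + (X n ω' - r) := fun ω' => by
        push_cast
        ring
      simp only [heq]
      linarith
    have hd := hsum.expect_lipschitz_add (hX n) (hlip ((n + 1 : ℕ) * r))
    have h1 := (hsum.comp_lipschitz (hlip (n * r))).expect_mono
      (hd.add (S.dominated_const (4 * C))) fun ω => hstep _
    have h2 := hd.expect_add_const_le (4 * C)
    rw [← hind.expect_lipschitz_sum_succ hX hα hXp (hlip _)] at h2
    push_cast at h1 h2 ⊢
    linarith

theorem mul_four_mul_rpow_inv {C : ℝ} (hα : 0 < α) (hC : 0 ≤ C) {n : ℕ} (hn : 1 ≤ n) :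
    (n * (4 * C)) ^ (1 + α)⁻¹ = n * (4 * C / (n : ℝ) ^ α) ^ (1 / (1 + α)) := by
  have hn0 : (0 : ℝ) < n := by exact_mod_cast hn
  have h : n * (4 * C) = (n : ℝ) ^ (1 + α) * (4 * C / (n : ℝ) ^ α) := by
    rw [Real.rpow_add hn0, Real.rpow_one]
    field_simp
  rw [h, Real.mul_rpow (by positivity) (by positivity), Real.rpow_rpow_inv hn0.le (by linarith),
    one_div]

theorem abs_sub_clampDev_mul {a b n x : ℝ} (hab : a ≤ b) (hn : 0 < n) :
    ∃ y ∈ Set.Icc a b, |x / n - y| = |clampDev (n * a) (n * b) x| / n := by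
  have hab' : n * a ≤ n * b := by gcongr
  refine ⟨max (n * a) (min x (n * b)) / n, ⟨?_, ?_⟩, ?_⟩
  · rw [le_div_iff₀' hn]
    exact le_max_left _ _
  · rw [div_le_iff₀' hn]
    exact max_le hab' (min_le_right _ _)
  · rw [← sub_div, abs_div, abs_of_pos hn, clampDev]

end Sums

end SublinearExpectationSpace

/-! ### The law of large numbers with rate -/

theorem theorem3p1 {Ω : Type*} (S : SublinearExpectationSpace Ω)
    (X : ℕ → Ω → ℝ) (hX : ∀ i, S.MemCompletion (X i)) (hind : S.Independent X)
    (μu μl : ℝ) (hμu : ∀ i, S.expect (X i) = μu) (hμl : ∀ i, -S.expect (fun ω => -X i ω) = μl)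
    (α : ℝ) (hα : α ∈ Set.Ioc (0 : ℝ) 1)
    (hmem : ∀ i, S.MemCompletion (fun ω => |X i ω| ^ (1 + α)))
    (hbdd : BddAbove (Set.range fun i => S.expect (fun ω => |X i ω| ^ (1 + α))))
    (C : ℝ) (hC : C = ⨆ i, S.expect (fun ω => |X i ω| ^ (1 + α)))
    (φ : ℝ → ℝ) (L : NNReal) (hφ : LipschitzWith L φ) :
    ∃ M : ℝ, IsGreatest (φ '' Set.Icc μl μu) M ∧
      ∀ n : ℕ, 1 ≤ n →
        S.MemCompletion (fun ω => φ ((∑ i ∈ Finset.range n, X i ω) / n)) ∧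
        |S.expect (fun ω => φ ((∑ i ∈ Finset.range n, X i ω) / n)) - M| ≤
          L * (4 * C / (n : ℝ) ^ α) ^ (1 / (1 + α)) := by
  obtain ⟨hα, hα'⟩ := hα
  have hXd : ∀ i, S.Dominated (X i) := fun i => (hX i).dominated
  have hXp : ∀ i, S.Dominated (fun ω => |X i ω| ^ (1 + α)) := fun i => (hmem i).dominated
  have hCi : ∀ i, S.expect (fun ω => |X i ω| ^ (1 + α)) ≤ C := fun i => hC ▸ le_ciSup hbdd i
  have hC0 : 0 ≤ C := ((hXp 0).expect_nonneg fun ω => by positivity).trans (hCi 0)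
  have hlu : μl ≤ μu := by
    rw [← hμu 0, ← hμl 0]
    exact (hXd 0).neg_expect_neg_le
  have hp : 0 < 1 + α := by linarith
  obtain ⟨r, hr, hmax⟩ := isCompact_Icc.exists_isMaxOn (Set.nonempty_Icc.2 hlu)
    hφ.continuous.continuousOn
  refine ⟨φ r, ⟨Set.mem_image_of_mem _ hr, Set.forall_mem_image.2 fun x hx => hmax hx⟩,
    fun n hn => ?_⟩
  have hn0 : (0 : ℝ) < n := by exact_mod_cast hn
  have hlip : LipschitzWith (L * ‖(n : ℝ)⁻¹‖₊) (fun x => φ (x / n)) := by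
    refine hφ.comp (LipschitzWith.of_dist_le_mul fun x y => ?_)
    rw [Real.dist_eq, Real.dist_eq, ← sub_div, abs_div, div_eq_inv_mul, coe_nnnorm, norm_inv,
      Real.norm_eq_abs]
  refine ⟨SublinearExpectationSpace.memCompletion_lipschitz_sum hX hα hXp hlip n, ?_⟩
  set T : Ω → ℝ := fun ω => ∑ i ∈ Finset.range n, X i ω with hT
  have hTd : S.Dominated T := SublinearExpectationSpace.Dominated.sum _ hXd
  have hφd : S.Dominated (fun ω => φ (T ω / n)) := hTd.comp_lipschitz hlip
  set R := (4 * C / (n : ℝ) ^ α) ^ (1 / (1 + α)) with hR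
  have hLn : (0 : ℝ) ≤ L / n := by positivity
  have hLR : L / n * (n * R) = L * R := by
    field_simp
  have hupper : S.expect (fun ω =>
      |SublinearExpectationSpace.clampDev (n * μl) (n * μu) (T ω)|) ≤ n * R := by
    rw [hR, ← SublinearExpectationSpace.mul_four_mul_rpow_inv hα hC0 hn]
    -- The truncation level is `t` itself, so the tangent at `t` is available.
    refine SublinearExpectationSpace.le_rpow_inv_of_forall hp (by positivity) fun t ht htC => ?_
    have hd := hTd.comp_lipschitz
      (SublinearExpectationSpace.lipschitzWith_clampDev (n * μl) (n * μu))
    exact hd.expect_abs_le_of_tangent_le hα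
      (hd.comp_lipschitz (lipschitzWith_truncPow hα ht.le)) ht (fun ω => le_truncPow hα ht.le _)
      ((hind.expect_truncPow_clampDev_sum_le hXd hα hα' hXp hCi hμu hμl ht.le n).trans htC)
  have hlower : -S.expect (fun ω => -|T ω - n * r|) ≤ n * R := by
    rw [hR, ← SublinearExpectationSpace.mul_four_mul_rpow_inv hα hC0 hn]
    refine SublinearExpectationSpace.le_rpow_inv_of_forall hp (by positivity) fun t ht htC => ?_
    have hd := hTd.sub_const (n * r)
    rw [neg_le]
    exact hd.neg_expect_neg_abs_le_of_tangent_le hα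
      (hd.comp_lipschitz (lipschitzWith_truncPow hα ht.le)) ht (fun ω => le_truncPow hα ht.le _)
      ((neg_le_neg htC).trans (hind.le_expect_neg_truncPow_sum hXd hα hα' hXp hCi
        (fun i => (hμu i).symm ▸ hr.2) (fun i => (hμl i).trans_le hr.1) ht.le n))
  rw [abs_le]
  constructor
  · have hd := (hTd.sub_const (n * r)).abs.neg
    -- The upper expectation of `-|T - n r|` enters, so only the lower expectation of `|T - n r|`
    -- must be small.
    have h1 := (hd.const_mul (L / n)).expect_mono (hφd.add (S.dominated_const (-φ r)))
      fun ω => by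
        have h := (abs_le.1 (hφ.abs_sub_le (T ω / n) r)).1
        have h2 : (L : ℝ) * |T ω / n - r| = L / n * |T ω - n * r| := by
          rw [div_sub' hn0.ne', abs_div, abs_of_pos hn0]
          ring
        linarith
    rw [hd.expect_const_mul hLn] at h1
    have h2 := hφd.expect_add_const_le (-φ r)
    have h3 := mul_le_mul_of_nonneg_left hlower hLn
    linarith
  · have hd := (hTd.comp_lipschitz
      (SublinearExpectationSpace.lipschitzWith_clampDev (n * μl) (n * μu))).abs
    have h1 := hφd.expect_mono ((hd.const_mul (L / n)).add (S.dominated_const (φ r)))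
      fun ω => by
        -- `y` is the point of `[μl, μu]` nearest to `T ω / n`; there `φ y ≤ φ r`.
        obtain ⟨y, hy, hxy⟩ := SublinearExpectationSpace.abs_sub_clampDev_mul (x := T ω) hlu hn0
        have h := (abs_le.1 (hφ.abs_sub_le (T ω / n) y)).2
        have h2 : φ y ≤ φ r := hmax hy
        rw [hxy, ← mul_div_assoc, mul_div_right_comm] at h
        linarith
    have h2 := (hd.const_mul (L / n)).expect_add_const_le (φ r)
    rw [hd.expect_const_mul hLn] at h2
    have h3 := mul_le_mul_of_nonneg_left hupper hLn
    linarith
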